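/- **Theorem (unilateral Liouville property).** Let $n\ge 1$ and let $a=(a_1,\dots,a_n)\in\mathbb R^n$ satisfy $a_i\ge 0$ for all $i$ and $a_j>0$ for at least one $j$. For a real symmetric $n\times n$ matrix $X$ with eigenvalues $\lambda_1(X)\le\dots\le\lambda_n(X)$ (counted with multiplicity) put $$\mathcal M_a(X)=\sum_{i=1}^n a_i\lambda_i(X),\qquad \hat a_j=(a_1+\dots+a_n)-a_j .$$ Let $\mathcal O\subseteq\mathbb R^n$ be open. A viscosity subsolution of $\mathcal M_a(D^2u)=0$ in $\mathcal O$ is an upper semicontinuous function $u:\mathcal O\to\mathbb R$ such that $\mathcal M_a(X)\ge 0$ whenever $x_0\in\mathcal O$, $\xi\in\mathbb R^n$ and the symmetric matrix $X$ satisfy $$u(x)\le u(x_0)+\langle\xi,x-x_0\rangle+\tfrac12\langle X(x-x_0),x-x_0\rangle+o(|x-x_0|^2)\quad\text{as }x\to x_0 .$$ A viscosity supersolution is a lower semicontinuous function $u:\mathcal O\to\mathbb R$ such that $\mathcal M_a(X)\le 0$ whenever the same holds with $\ge$ in place of $\le$. Then: 1. If $a_1=\hat a_1$ (for instance $\mathcal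 M_a=\lambda_1+\lambda_n$ with $n\ge 2$), every viscosity subsolution of $\mathcal M_a(D^2u)=0$ in $\mathbb R^n\setminus\{0\}$ that is bounded above is constant. 2. If $a_1>\hat a_1$, every viscosity subsolution of $\mathcal M_a(D^2u)=0$ in $\mathbb R^n$ that is bounded above is constant. 3. If $a_n=\hat a_n$, every viscosity supersolution of $\mathcal M_a(D^2v)=0$ in $\mathbb R^n\setminus\{0\}$ that is bounded below is constant. 4. If $a_n>\hat a_n$, every viscosity supersolution of $\mathcal M_a(D^2v)=0$ in $\mathbb R^n$ that is bounded below is constant. -/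

import Mathlib

open Filter Topology Asymptotics

noncomputable section

namespace WeightedTrace

/-- Euclidean space `ℝⁿ`. -/
abbrev Euc (n : ℕ) : Type := EuclideanSpace ℝ (Fin n)

/-- The real symmetric `n × n` matrices (over `ℝ`, Hermitian means symmetric). -/
abbrev SymMat (n : ℕ) : Type := {X : Matrix (Fin n) (Fin n) ℝ // X.IsHermitian}

/-- The eigenvalues of a symmetric matrix, counted with multiplicity and listed in
nondecreasing order. (Mathlib's `eigenvalues₀` lists them in nonincreasing order, hence the
reversal.) -/
def eig {n : ℕ} (X : SymMat n) (i : Fin n) : ℝ :=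
  X.2.eigenvalues₀ (Fin.cast (Fintype.card_fin n).symm i.rev)

/-- The weighted partial trace operator `X ↦ ∑ i, a i * λ i (X)`. -/
def weightedTrace {n : ℕ} (a : Fin n → ℝ) (X : SymMat n) : ℝ :=
  ∑ i, a i * eig X i

/-- The admissible weights: nonnegative, and not all zero. -/
def AdmissibleWeights {n : ℕ} (a : Fin n → ℝ) : Prop :=
  (∀ i, 0 ≤ a i) ∧ ∃ i, 0 < a i

/-- The complementary weight: the sum of all the weights, minus the `j`-th one. -/
def complWeight {n : ℕ} (a : Fin n → ℝ) (j : Fin n) : ℝ :=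
  (∑ i, a i) - a j

/-- The quadratic polynomial `c + ⟨ξ, x - x₀⟩ + ½ ⟨X (x - x₀), x - x₀⟩`. -/
def quadPoly {n : ℕ} (c : ℝ) (ξ : Euc n) (X : SymMat n) (x₀ x : Euc n) : ℝ :=
  c + inner ℝ ξ (x - x₀)
    + (1 / 2) * inner ℝ (Matrix.toEuclideanLin X.1 (x - x₀)) (x - x₀)

/-- The second order superjet of `u` at `x₀` relative to `O`: the pairs `(ξ, X)` such that
`u x ≤ u x₀ + ⟨ξ, x - x₀⟩ + ½ ⟨X (x - x₀), x - x₀⟩ + o(|x - x₀|²)` as `x → x₀` in `O`. -/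
def superjet {n : ℕ} (O : Set (Euc n)) (u : Euc n → ℝ) (x₀ : Euc n) :
    Set (Euc n × SymMat n) :=
  {p | ∃ ρ : Euc n → ℝ, ρ =o[𝓝[O] x₀] (fun x => ‖x - x₀‖ ^ 2) ∧
    ∀ᶠ x in 𝓝[O] x₀, u x ≤ quadPoly (u x₀) p.1 p.2 x₀ x + ρ x}

/-- The second order subjet of `u` at `x₀` relative to `O`. -/
def subjet {n : ℕ} (O : Set (Euc n)) (u : Euc n → ℝ) (x₀ : Euc n) :
    Set (Euc n × SymMat n) :=
  {p | ∃ ρ : Euc n → ℝ, ρ =o[𝓝[O] x₀] (fun x => ‖x - x₀‖ ^ 2) ∧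
    ∀ᶠ x in 𝓝[O] x₀, quadPoly (u x₀) p.1 p.2 x₀ x + ρ x ≤ u x}

/-- `u` is a viscosity subsolution of `F(D²u) = f` in `O`. Only the values of `u` on `O`
matter. -/
def IsViscositySubsolution {n : ℕ} (F : SymMat n → ℝ) (f : Euc n → ℝ) (O : Set (Euc n))
    (u : Euc n → ℝ) : Prop :=
  UpperSemicontinuousOn u O ∧
    ∀ x ∈ O, ∀ ξ : Euc n, ∀ X : SymMat n, (ξ, X) ∈ superjet O u x → f x ≤ F X

/-- `u` is a viscosity supersolution of `F(D²u) = f` in `O`. Only the values of `u` on `O`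
matter. -/
def IsViscositySupersolution {n : ℕ} (F : SymMat n → ℝ) (f : Euc n → ℝ) (O : Set (Euc n))
    (u : Euc n → ℝ) : Prop :=
  LowerSemicontinuousOn u O ∧
    ∀ x ∈ O, ∀ ξ : Euc n, ∀ X : SymMat n, (ξ, X) ∈ subjet O u x → F X ≤ f x

end WeightedTrace

end

/-!
If `â₁ ≤ a₁`, then `M_a(X) ≥ 0` forces `λ₁(X) + λₙ(X) ≥ 0`, so a subsolution for `M_a` is one for
`λ₁ + λₙ`. The Hessian at `z` of a radial function `g(|x|²)` has the eigenvalues `2g'` and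
`2g' + 4g''|z|²`, so in every dimension `n ≥ 2` the operator `λ₁ + λₙ` evaluates on it to
`4(g' + g''|z|²)`, as the Laplacian of the plane does: `log |x|` is a radial solution. Hence
subsolutions satisfy the Hadamard three-spheres theorem. On the one hand this yields the strong
maximum principle. On the other hand, letting the inner radius tend to `0` and the outer one to
`∞`, a subsolution on a punctured space that is bounded above is bounded by its maximum over the
unit sphere, so the strong maximum principle makes it constant.

On the whole space with `n ≥ 2` one removes a point different from the two points to be compared;
for `n = 1` one compares with `ε |x - y|^{1/2}`. Supersolutions `v` are handled through `-v`,
because `X ↦ -X` reverses the order of the eigenvalues and hence of the weights.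
-/

namespace WeightedTrace

theorem charpoly_roots_of_basis {ι K V : Type*} [Fintype ι] [Field K] [AddCommGroup V]
    [Module K V] [Module.Free K V] [Module.Finite K V] {T : V →ₗ[K] V} (b : Module.Basis ι K V)
    {μ : ι → K} (h : ∀ i, T (b i) = μ i • b i) : T.charpoly.roots = Finset.univ.val.map μ := by
  classical
  have hdiag : LinearMap.toMatrix b b T = Matrix.diagonal μ := by
    ext i j
    rcases eq_or_ne i j with rfl | hij <;> simp [LinearMap.toMatrix_apply, *]
  rw [← LinearMap.charpoly_toMatrix T b, hdiag, Matrix.charpoly_diagonal]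
  simpa using Polynomial.roots_multiset_prod_X_sub_C (Finset.univ.val.map μ)

theorem eq_of_monotone_of_map_eq {n : ℕ} {α : Type*} [LinearOrder α] {f g : Fin n → α}
    (hf : Monotone f) (hg : Monotone g)
    (h : (Finset.univ.val.map f : Multiset α) = Finset.univ.val.map g) : f = g := by
  rw [Fin.univ_val_map, Fin.univ_val_map, Multiset.coe_eq_coe] at h
  exact List.ofFn_injective (h.eq_of_pairwise' hf.sortedLE_ofFn.pairwise hg.sortedLE_ofFn.pairwise)

variable {n : ℕ}

theorem eig_monotone (X : SymMat n) : Monotone (eig X) := fun _ _ hij =>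
  X.2.eigenvalues₀_antitone (Fin.rev_le_rev.2 hij)

theorem exists_orthonormalBasis_eig (X : SymMat n) :
    ∃ b : OrthonormalBasis (Fin n) ℝ (Euc n),
      ∀ i, Matrix.toEuclideanLin X.1 (b i) = eig X i • b i := by
  have hX := Matrix.isSymmetric_toEuclideanLin_iff.mpr X.2
  refine ⟨(hX.eigenvectorBasis finrank_euclideanSpace).reindex
    ((finCongr (Fintype.card_fin n)).trans Fin.revPerm), fun i => ?_⟩
  rw [OrthonormalBasis.reindex_apply, hX.apply_eigenvectorBasis]
  rfl

theorem eig_eq_of_basis {X : SymMat n} (b : Module.Basis (Fin n) ℝ (Euc n)) {μ : Fin n → ℝ}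
    (hμ : Monotone μ) (h : ∀ i, Matrix.toEuclideanLin X.1 (b i) = μ i • b i) : eig X = μ := by
  obtain ⟨b', hb'⟩ := exists_orthonormalBasis_eig X
  refine eq_of_monotone_of_map_eq (eig_monotone X) hμ ?_
  rw [← charpoly_roots_of_basis b h, charpoly_roots_of_basis b'.toBasis (by simpa using hb')]

theorem eig_neg (X : SymMat n) (i : Fin n) : eig ⟨-X.1, X.2.neg⟩ i = -eig X i.rev := by
  obtain ⟨b, hb⟩ := exists_orthonormalBasis_eig X
  refine congrFun (eig_eq_of_basis (b.toBasis.reindex Fin.revPerm)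
    (μ := fun i => -eig X i.rev) ?_ ?_) i
  · exact fun i j hij => neg_le_neg (eig_monotone X (Fin.rev_le_rev.2 hij))
  · intro i
    simp [hb]

theorem inner_eq_sum_eig {X : SymMat n} {b : OrthonormalBasis (Fin n) ℝ (Euc n)}
    (hb : ∀ i, Matrix.toEuclideanLin X.1 (b i) = eig X i • b i) (e : Euc n) :
    inner ℝ (Matrix.toEuclideanLin X.1 e) e = ∑ i, eig X i * inner ℝ (b i) e ^ 2 := by
  rw [← b.sum_inner_mul_inner]
  refine Finset.sum_congr rfl fun i _ => ?_
  rw [Matrix.isSymmetric_toEuclideanLin_iff.mpr X.2 e (b i), hb, real_inner_smul_right,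
    real_inner_comm e]
  ring

theorem eig_zero_le_inner (hn : 0 < n) (X : SymMat n) {e : Euc n} (he : ‖e‖ = 1) :
    eig X ⟨0, hn⟩ ≤ inner ℝ (Matrix.toEuclideanLin X.1 e) e := by
  obtain ⟨b, hb⟩ := exists_orthonormalBasis_eig X
  calc eig X ⟨0, hn⟩ = ∑ i, eig X ⟨0, hn⟩ * inner ℝ (b i) e ^ 2 := by
        have hparseval := b.sum_sq_norm_inner_right e
        simp only [Real.norm_eq_abs, sq_abs] at hparseval
        rw [← Finset.mul_sum, hparseval, he, one_pow, mul_one]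
    _ ≤ ∑ i, eig X i * inner ℝ (b i) e ^ 2 := by
        gcongr
        exact eig_monotone X (Fin.le_def.2 (Nat.zero_le _))
    _ = inner ℝ (Matrix.toEuclideanLin X.1 e) e := (inner_eq_sum_eig hb e).symm

theorem eig_le_of_forall_inner_le {X : SymMat n} {C : ℝ}
    (hC : ∀ v : Euc n, inner ℝ (Matrix.toEuclideanLin X.1 v) v ≤ C * ‖v‖ ^ 2) (i : Fin n) :
    eig X i ≤ C := by
  obtain ⟨b, hb⟩ := exists_orthonormalBasis_eig X
  simpa [hb, real_inner_smul_left] using hC (b i)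

theorem weightedTrace_neg (a : Fin n → ℝ) (X : SymMat n) :
    weightedTrace a ⟨-X.1, X.2.neg⟩ = -weightedTrace (a ∘ Fin.rev) X := by
  simp only [weightedTrace, eig_neg, mul_neg, Finset.sum_neg_distrib, Function.comp_apply]
  rw [← Equiv.sum_comp Fin.revPerm]
  simp

theorem complWeight_comp_rev (a : Fin n → ℝ) (j : Fin n) :
    complWeight (a ∘ Fin.rev) j = complWeight a j.rev := by
  simpa [complWeight] using Equiv.sum_comp Fin.revPerm a

theorem AdmissibleWeights.comp_rev {a : Fin n → ℝ} (ha : AdmissibleWeights a) :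
    AdmissibleWeights (a ∘ Fin.rev) :=
  ⟨fun i => ha.1 i.rev, ha.2.imp' Fin.rev fun i hi => by simpa using hi⟩

theorem AdmissibleWeights.pos_of_complWeight_le {a : Fin n → ℝ} (ha : AdmissibleWeights a)
    {j : Fin n} (h : complWeight a j ≤ a j) : 0 < a j := by
  have hsum : 0 < ∑ i, a i :=
    Finset.sum_pos' (fun i _ => ha.1 i) (ha.2.imp fun i hi => ⟨Finset.mem_univ i, hi⟩)
  rw [complWeight] at h
  linarith

theorem AdmissibleWeights.two_le_of_eq_complWeight {a : Fin n → ℝ} (ha : AdmissibleWeights a)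
    {j : Fin n} (h : a j = complWeight a j) : 2 ≤ n := by
  have hpos := ha.pos_of_complWeight_le h.ge
  by_contra! hlt
  obtain rfl : n = 1 := by have := j.2; omega
  rw [complWeight, Fintype.sum_subsingleton a j, sub_self] at h
  exact hpos.ne' h

/-- The operator `X ↦ λ₁(X) + λₙ(X)`, to which every weighted partial trace with
`complWeight a 0 ≤ a 0` reduces. -/
noncomputable def extremeEigSum (hn : 0 < n) (X : SymMat n) : ℝ :=
  eig X ⟨0, hn⟩ + eig X ⟨n - 1, Nat.sub_lt hn one_pos⟩

theorem eig_le_eig_last (hn : 0 < n) (X : SymMat n) (i : Fin n) :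
    eig X i ≤ eig X ⟨n - 1, Nat.sub_lt hn one_pos⟩ :=
  eig_monotone X (Fin.le_def.2 (Nat.le_sub_one_of_lt i.2))

theorem weightedTrace_le (hn : 0 < n) {a : Fin n → ℝ} (ha : ∀ i, 0 ≤ a i) (X : SymMat n) :
    weightedTrace a X ≤ a ⟨0, hn⟩ * eig X ⟨0, hn⟩ +
      complWeight a ⟨0, hn⟩ * eig X ⟨n - 1, Nat.sub_lt hn one_pos⟩ := by
  have hcompl : complWeight a ⟨0, hn⟩ = ∑ i ∈ Finset.univ.erase ⟨0, hn⟩, a i := by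
    rw [complWeight, ← Finset.sum_erase_eq_sub (Finset.mem_univ _)]
  rw [weightedTrace, ← Finset.add_sum_erase _ _ (Finset.mem_univ ⟨0, hn⟩), hcompl, Finset.sum_mul]
  gcongr with i
  · exact ha i
  · exact eig_le_eig_last hn X i

theorem extremeEigSum_nonneg (hn : 0 < n) {a : Fin n → ℝ} (ha : AdmissibleWeights a)
    (hle : complWeight a ⟨0, hn⟩ ≤ a ⟨0, hn⟩) {X : SymMat n} (hX : 0 ≤ weightedTrace a X) :
    0 ≤ extremeEigSum hn X := by
  have hpos := ha.pos_of_complWeight_le hle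
  have hcompl : 0 ≤ complWeight a ⟨0, hn⟩ :=
    sub_nonneg.2 (Finset.single_le_sum (fun i _ => ha.1 i) (Finset.mem_univ _))
  have htrace := hX.trans (weightedTrace_le hn ha.1 X)
  have hmono := eig_le_eig_last hn X ⟨0, hn⟩
  rw [extremeEigSum]
  by_contra! hneg
  rcases le_or_gt 0 (eig X ⟨n - 1, Nat.sub_lt hn one_pos⟩) with hlast | hlast <;> nlinarith

theorem IsViscositySubsolution.mono {F : SymMat n → ℝ} {f : Euc n → ℝ} {O U : Set (Euc n)}
    {u : Euc n → ℝ} (h : IsViscositySubsolution F f O u) (hU : IsOpen U) (hUO : U ⊆ O) :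
    IsViscositySubsolution F f U u := by
  refine ⟨h.1.mono hUO, fun x hx ξ X ⟨ρ, hρ, hle⟩ => h.2 x (hUO hx) ξ X ⟨ρ, ?_, ?_⟩⟩
  all_goals rw [hU.nhdsWithin_eq hx] at *
  · exact hρ.mono nhdsWithin_le_nhds
  · exact hle.filter_mono nhdsWithin_le_nhds

theorem IsViscositySubsolution.of_forall_nonneg {F G : SymMat n → ℝ} {O : Set (Euc n)}
    {u : Euc n → ℝ} (h : IsViscositySubsolution F (fun _ => 0) O u) (hFG : ∀ X, 0 ≤ F X → 0 ≤ G X) :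
    IsViscositySubsolution G (fun _ => 0) O u :=
  ⟨h.1, fun x hx ξ X hX => hFG X (h.2 x hx ξ X hX)⟩

theorem IsViscositySupersolution.neg {F : SymMat n → ℝ} {f : Euc n → ℝ} {O : Set (Euc n)}
    {v : Euc n → ℝ} (h : IsViscositySupersolution F f O v) :
    IsViscositySubsolution (fun X => -F ⟨-X.1, X.2.neg⟩) (-f) O (-v) := by
  refine ⟨fun x hx c hc => ?_, fun x hx ξ X ⟨ρ, hρ, hle⟩ => neg_le_neg ?_⟩
  · filter_upwards [h.1 x hx (-c) (neg_lt.1 hc)] with z hz using neg_lt.1 hz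
  · refine h.2 x hx (-ξ) ⟨-X.1, X.2.neg⟩ ⟨-ρ, hρ.neg_left, hle.mono fun z hz => ?_⟩
    simp only [quadPoly, map_neg, LinearMap.neg_apply, inner_neg_left, Pi.neg_apply] at hz ⊢
    linarith

theorem IsViscositySupersolution.isViscositySubsolution_weightedTrace_rev {a : Fin n → ℝ}
    {O : Set (Euc n)} {v : Euc n → ℝ}
    (h : IsViscositySupersolution (weightedTrace a) (fun _ => 0) O v) :
    IsViscositySubsolution (weightedTrace (a ∘ Fin.rev)) (fun _ => 0) O (-v) := by
  simpa only [weightedTrace_neg, neg_neg, Pi.neg_def, neg_zero] using h.neg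

theorem mem_superjet_of_isLocalMax_sub {O : Set (Euc n)} {u φ : Euc n → ℝ} {x₀ ξ : Euc n}
    {X : SymMat n}
    (hφ : (fun x => φ x - quadPoly (φ x₀) ξ X x₀ x) =o[𝓝 x₀] fun x => ‖x - x₀‖ ^ 2)
    (hmax : IsLocalMax (u - φ) x₀) : (ξ, X) ∈ superjet O u x₀ := by
  refine ⟨_, hφ.mono nhdsWithin_le_nhds,
    (hmax.filter_mono nhdsWithin_le_nhds).mono fun x hx => ?_⟩
  simp only [quadPoly, Pi.sub_apply] at hx ⊢
  linarith

theorem isLittleO_second_order_taylor {g g' : ℝ → ℝ} {q s₀ : ℝ}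
    (hg : ∀ᶠ s in 𝓝 s₀, HasDerivAt g (g' s) s) (hg' : HasDerivAt g' q s₀) :
    (fun s => g s - g s₀ - g' s₀ * (s - s₀) - q / 2 * (s - s₀) ^ 2) =o[𝓝 s₀]
      fun s => (s - s₀) ^ 2 := by
  obtain ⟨r, hr, hball⟩ := Metric.eventually_nhds_iff_ball.1 hg
  have hs₀ := Metric.mem_ball_self (x := s₀) hr
  have hfirst : (fun s => g' s - g' s₀ - (s - s₀) * q) =o[𝓝[Metric.ball s₀ r] s₀]
      fun s => (s - s₀) ^ 1 := by
    simpa using (hasDerivAt_iff_isLittleO.1 hg').mono nhdsWithin_le_nhds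
  have hsecond := (convex_ball s₀ r).isLittleO_pow_succ_real
    (f := fun s => g s - g' s₀ * (s - s₀) - q / 2 * (s - s₀) ^ 2) hs₀ (fun s hs => by
      have hlin := (hasDerivAt_id s).sub_const s₀
      refine ((((hball s hs).sub (hlin.const_mul (g' s₀))).sub
        ((hlin.pow 2).const_mul (q / 2))).congr_deriv ?_).hasDerivWithinAt
      simp only [id_eq, Nat.cast_ofNat]
      ring) hfirst
  rw [Metric.isOpen_ball.nhdsWithin_eq hs₀] at hsecond
  refine hsecond.congr_left fun s => ?_
  ring

theorem isLittleO_radial_taylor {E : Type*} [NormedAddCommGroup E] [InnerProductSpace ℝ E]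
    {g g' : ℝ → ℝ} {q : ℝ} {x₀ y : E}
    (hg : ∀ᶠ s in 𝓝 (‖x₀ - y‖ ^ 2), HasDerivAt g (g' s) s)
    (hg' : HasDerivAt g' q (‖x₀ - y‖ ^ 2)) :
    (fun x => g (‖x - y‖ ^ 2) - (g (‖x₀ - y‖ ^ 2)
      + g' (‖x₀ - y‖ ^ 2) * (2 * inner ℝ (x₀ - y) (x - x₀) + ‖x - x₀‖ ^ 2)
      + 2 * q * inner ℝ (x₀ - y) (x - x₀) ^ 2)) =o[𝓝 x₀] fun x => ‖x - x₀‖ ^ 2 := by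
  have hsub (x : E) : ‖x - y‖ ^ 2 - ‖x₀ - y‖ ^ 2 =
      2 * inner ℝ (x₀ - y) (x - x₀) + ‖x - x₀‖ ^ 2 := by
    rw [← sub_add_sub_cancel' x₀ y x, norm_add_sq_real]
    ring
  have hnorm : (fun x => ‖x - x₀‖) =o[𝓝 x₀] fun _ => (1 : ℝ) :=
    (isLittleO_one_iff ℝ).2 (tendsto_iff_norm_sub_tendsto_zero.1 tendsto_id)
  have hsq : (fun x => ‖x - x₀‖ ^ 2) =o[𝓝 x₀] fun x => ‖x - x₀‖ := by
    simpa [sq] using hnorm.mul_isBigO (isBigO_refl (fun x => ‖x - x₀‖) (𝓝 x₀))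
  have hinner : (fun x => inner ℝ (x₀ - y) (x - x₀)) =O[𝓝 x₀] fun x => ‖x - x₀‖ :=
    IsBigO.of_bound ‖x₀ - y‖ (Eventually.of_forall fun x => by
      simpa using norm_inner_le_norm (𝕜 := ℝ) (x₀ - y) (x - x₀))
  have hincr : (fun x => ‖x - y‖ ^ 2 - ‖x₀ - y‖ ^ 2) =O[𝓝 x₀] fun x => ‖x - x₀‖ := by
    simp only [hsub]
    exact (hinner.const_mul_left 2).add hsq.isBigO
  have htendsto : Tendsto (fun x => ‖x - y‖ ^ 2) (𝓝 x₀) (𝓝 (‖x₀ - y‖ ^ 2)) :=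
    Continuous.tendsto (by fun_prop) x₀
  have htaylor := ((isLittleO_second_order_taylor hg hg').comp_tendsto htendsto).trans_isBigO
    (hincr.pow 2)
  have hcross : (fun x => q / 2 * (‖x - x₀‖ ^ 2 *
      (4 * inner ℝ (x₀ - y) (x - x₀) + ‖x - x₀‖ ^ 2))) =o[𝓝 x₀] fun x => ‖x - x₀‖ ^ 2 := by
    simpa only [← sq] using
      (hsq.mul_isBigO ((hinner.const_mul_left 4).add hsq.isBigO)).const_mul_left (q / 2)
  refine (htaylor.add hcross).congr_left fun x => ?_
  simp only [Function.comp_apply, hsub]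
  ring

/-- The Hessian of `x ↦ g (‖x - y‖ ^ 2)` at `y + z`, where `p` and `q` are the first two
derivatives of `g` at `‖z‖ ^ 2`. -/
noncomputable def radialHessian (p q : ℝ) (z : Euc n) : SymMat n :=
  ⟨(2 * p) • 1 + (4 * q) • Matrix.vecMulVec z.ofLp z.ofLp, by
    ext i j
    simp [Matrix.vecMulVec_apply, Matrix.one_apply, eq_comm, mul_comm]⟩

theorem inner_radialHessian (p q : ℝ) (z v : Euc n) :
    inner ℝ (Matrix.toEuclideanLin (radialHessian p q z).1 v) v =
      2 * p * ‖v‖ ^ 2 + 4 * q * inner ℝ z v ^ 2 := by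
  have happly : Matrix.toEuclideanLin (radialHessian p q z).1 v =
      (2 * p) • v + (4 * q * inner ℝ z v) • z := by
    ext i
    simp [radialHessian, Matrix.vecMulVec_mulVec, EuclideanSpace.inner_eq_star_dotProduct,
      dotProduct_comm, mul_assoc, mul_comm, mul_left_comm]
  rw [happly, inner_add_left, real_inner_smul_left, real_inner_smul_left,
    real_inner_self_eq_norm_sq]
  ring

theorem radial_mem_superjet {O : Set (Euc n)} {u : Euc n → ℝ} {x₀ y : Euc n} {g g' : ℝ → ℝ}
    {q : ℝ} (hg : ∀ᶠ s in 𝓝 (‖x₀ - y‖ ^ 2), HasDerivAt g (g' s) s)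
    (hg' : HasDerivAt g' q (‖x₀ - y‖ ^ 2))
    (hmax : IsLocalMax (u - fun x => g (‖x - y‖ ^ 2)) x₀) :
    ((2 * g' (‖x₀ - y‖ ^ 2)) • (x₀ - y), radialHessian (g' (‖x₀ - y‖ ^ 2)) q (x₀ - y)) ∈
      superjet O u x₀ := by
  refine mem_superjet_of_isLocalMax_sub ((isLittleO_radial_taylor hg hg').congr_left fun x => ?_)
    hmax
  rw [quadPoly, inner_radialHessian, real_inner_smul_left]
  ring

theorem eig_zero_radialHessian_le (hn : 0 < n) (p q : ℝ) {z : Euc n} (hz : z ≠ 0) :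
    eig (radialHessian p q z) ⟨0, hn⟩ ≤ 2 * p + 4 * q * ‖z‖ ^ 2 := by
  have hunit : ‖‖z‖⁻¹ • z‖ = 1 := norm_smul_inv_norm hz
  have hinner : inner ℝ z (‖z‖⁻¹ • z) = ‖z‖ := by
    rw [real_inner_smul_right, real_inner_self_eq_norm_sq]
    field_simp
  have hle := eig_zero_le_inner hn (radialHessian p q z) hunit
  rwa [inner_radialHessian, hunit, hinner, one_pow, mul_one] at hle

theorem exists_norm_eq_one_inner_eq_zero {E : Type*} [NormedAddCommGroup E]
    [InnerProductSpace ℝ E] [FiniteDimensional ℝ E] (hE : 1 < Module.finrank ℝ E) (z : E) :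
    ∃ e : E, ‖e‖ = 1 ∧ inner ℝ z e = 0 := by
  have hne : (ℝ ∙ z)ᗮ ≠ ⊥ := fun hbot => by
    rw [Submodule.orthogonal_eq_bot_iff] at hbot
    have hle := finrank_span_le_card (R := ℝ) ({z} : Set E)
    rw [hbot, finrank_top, Set.toFinset_singleton, Finset.card_singleton] at hle
    exact hE.not_ge hle
  obtain ⟨v, hv, hv0⟩ := Submodule.exists_mem_ne_zero_of_ne_bot hne
  refine ⟨‖v‖⁻¹ • v, norm_smul_inv_norm hv0, ?_⟩
  rw [real_inner_smul_right, Submodule.mem_orthogonal_singleton_iff_inner_right.1 hv, mul_zero]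

theorem extremeEigSum_radialHessian_le (hn : 2 ≤ n) (p q : ℝ) {z : Euc n} (hz : z ≠ 0) :
    extremeEigSum (two_pos.trans_le hn) (radialHessian p q z) ≤ 4 * (p + q * ‖z‖ ^ 2) := by
  have hn₀ : 0 < n := two_pos.trans_le hn
  have hfirst : eig (radialHessian p q z) ⟨0, hn₀⟩ ≤ 2 * p := by
    obtain ⟨e, he, hze⟩ :=
      exists_norm_eq_one_inner_eq_zero (by rwa [finrank_euclideanSpace_fin]) z
    have hle := eig_zero_le_inner hn₀ (radialHessian p q z) he
    rw [inner_radialHessian, he, hze] at hle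
    linarith
  have hlast : eig (radialHessian p q z) ⟨n - 1, Nat.sub_lt hn₀ one_pos⟩ ≤
      max (2 * p) (2 * p + 4 * q * ‖z‖ ^ 2) := by
    refine eig_le_of_forall_inner_le (fun v => ?_) _
    have hcs : inner ℝ z v ^ 2 ≤ ‖z‖ ^ 2 * ‖v‖ ^ 2 := by
      rw [← mul_pow]
      exact sq_le_sq' (neg_le_of_abs_le (abs_real_inner_le_norm z v)) (real_inner_le_norm z v)
    rw [inner_radialHessian, max_mul_of_nonneg _ _ (sq_nonneg _), le_max_iff]
    rcases le_total q 0 with hq | hq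
    · left
      nlinarith [sq_nonneg (inner ℝ z v : ℝ)]
    · right
      nlinarith
  -- Adding `min` and `max` avoids deciding which of the two Hessian eigenvalues is the larger.
  calc extremeEigSum hn₀ (radialHessian p q z)
      ≤ min (2 * p) (2 * p + 4 * q * ‖z‖ ^ 2) + max (2 * p) (2 * p + 4 * q * ‖z‖ ^ 2) :=
        add_le_add (le_min hfirst (eig_zero_radialHessian_le hn₀ p q hz)) hlast
    _ = 4 * (p + q * ‖z‖ ^ 2) := by rw [min_add_max]; ring

theorem le_of_forall_pos_le_add_mul {a b k : ℝ} (h : ∀ ε > 0, a ≤ b + ε * k) : a ≤ b := by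
  have htendsto : Tendsto (fun ε => b + ε * k) (𝓝[>] 0) (𝓝 b) :=
    (Continuous.tendsto' (by fun_prop) 0 b (by ring)).mono_left nhdsWithin_le_nhds
  exact ge_of_tendsto htendsto (eventually_mem_nhdsWithin.mono h)

theorem isCompact_setOf_norm_sub_mem_Icc {E : Type*} [SeminormedAddCommGroup E] [ProperSpace E]
    (y : E) (r R : ℝ) : IsCompact {x | ‖x - y‖ ∈ Set.Icc r R} :=
  (isCompact_closedBall y R).of_isClosed_subset
    (isClosed_Icc.preimage (f := fun x => ‖x - y‖) (by fun_prop))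
    fun _ hx => mem_closedBall_iff_norm.2 hx.2

theorem IsViscositySubsolution.le_radial_of_le_on_spheres {F : SymMat n → ℝ} {f : Euc n → ℝ}
    {O : Set (Euc n)} {u : Euc n → ℝ} (h : IsViscositySubsolution F f O u) {y : Euc n} {r R : ℝ}
    (hr : 0 ≤ r) (hO : ∀ x, ‖x - y‖ ∈ Set.Icc r R → x ∈ O) {g g' g'' : ℝ → ℝ}
    (hcont : ContinuousOn g (Set.Icc (r ^ 2) (R ^ 2)))
    (hg : ∀ s ∈ Set.Ioo (r ^ 2) (R ^ 2), HasDerivAt g (g' s) s)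
    (hg' : ∀ s ∈ Set.Ioo (r ^ 2) (R ^ 2), HasDerivAt g' (g'' s) s)
    (hstrict : ∀ x, ‖x - y‖ ∈ Set.Ioo r R →
      F (radialHessian (g' (‖x - y‖ ^ 2)) (g'' (‖x - y‖ ^ 2)) (x - y)) < f x)
    (hin : ∀ x, ‖x - y‖ = r → u x ≤ g (r ^ 2)) (hout : ∀ x, ‖x - y‖ = R → u x ≤ g (R ^ 2))
    {x : Euc n} (hx : ‖x - y‖ ∈ Set.Icc r R) : u x ≤ g (‖x - y‖ ^ 2) := by
  have husc : UpperSemicontinuousOn (fun x => u x + -g (‖x - y‖ ^ 2))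
      {x | ‖x - y‖ ∈ Set.Icc r R} := by
    refine (h.1.mono hO).add (ContinuousOn.upperSemicontinuousOn ?_)
    exact (hcont.comp (by fun_prop) fun w hw =>
      ⟨pow_le_pow_left₀ hr hw.1 2, pow_le_pow_left₀ (norm_nonneg _) hw.2 2⟩).neg
  obtain ⟨x₀, hx₀, hmax⟩ := UpperSemicontinuousOn.exists_isMaxOn ⟨x, hx⟩
    (isCompact_setOf_norm_sub_mem_Icc y r R) husc
  suffices u x₀ ≤ g (‖x₀ - y‖ ^ 2) by linarith [isMaxOn_iff.1 hmax x hx]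
  rcases hx₀.1.eq_or_lt with hr₀ | hr₀
  · exact hr₀ ▸ hin x₀ hr₀.symm
  rcases hx₀.2.eq_or_lt with hR₀ | hR₀
  · exact hR₀ ▸ hout x₀ hR₀
  have hs₀ : ‖x₀ - y‖ ^ 2 ∈ Set.Ioo (r ^ 2) (R ^ 2) :=
    ⟨pow_lt_pow_left₀ hr₀ hr two_ne_zero, pow_lt_pow_left₀ hR₀ (norm_nonneg _) two_ne_zero⟩
  have hlocal : IsLocalMax (u - fun x => g (‖x - y‖ ^ 2)) x₀ := by
    have hnear : ∀ᶠ x in 𝓝 x₀, ‖x - y‖ ∈ Set.Ioo r R :=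
      ContinuousAt.eventually_mem (by fun_prop) (Ioo_mem_nhds hr₀ hR₀)
    filter_upwards [hnear] with w hw
    simpa [← sub_eq_add_neg] using isMaxOn_iff.1 hmax w ⟨hw.1.le, hw.2.le⟩
  have hjet := radial_mem_superjet (O := O) ((isOpen_Ioo.eventually_mem hs₀).mono hg)
    (hg' _ hs₀) hlocal
  exact absurd (h.2 x₀ (hO x₀ hx₀) _ _ hjet) (hstrict x₀ ⟨hr₀, hR₀⟩).not_ge

theorem IsViscositySubsolution.le_add_mul_log_of_le_on_spheres (hn : 2 ≤ n) {O : Set (Euc n)}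
    {u : Euc n → ℝ}
    (h : IsViscositySubsolution (extremeEigSum (two_pos.trans_le hn)) (fun _ => 0) O u)
    {y : Euc n} {r R a b : ℝ} (hr : 0 < r) (hO : ∀ x, ‖x - y‖ ∈ Set.Icc r R → x ∈ O)
    (hin : ∀ x, ‖x - y‖ = r → u x ≤ a + b * Real.log r)
    (hout : ∀ x, ‖x - y‖ = R → u x ≤ a + b * Real.log R)
    {x : Euc n} (hx : ‖x - y‖ ∈ Set.Icc r R) : u x ≤ a + b * Real.log ‖x - y‖ := by
  refine le_of_forall_pos_le_add_mul (k := R ^ 2 - ‖x - y‖ ^ 2) fun ε hε => ?_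
  have hrR : r ≤ R := hx.1.trans hx.2
  have hpos {s : ℝ} (hs : r ^ 2 ≤ s) : s ≠ 0 := ((pow_pos hr 2).trans_le hs).ne'
  have hlog (s : ℝ) : b / 2 * Real.log (s ^ 2) = b * Real.log s := by
    rw [Real.log_pow]
    push_cast
    ring
  -- The term `ε * (R ^ 2 - s)` turns the solution `log` into a strict supersolution.
  have hbarrier := h.le_radial_of_le_on_spheres (y := y) hr.le hO
    (g := fun s => a + b / 2 * Real.log s + ε * (R ^ 2 - s)) (g' := fun s => b / 2 * s⁻¹ - ε)
    (g'' := fun s => b / 2 * -(s ^ 2)⁻¹) ?_ ?_ ?_ ?_ ?_ ?_ hx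
  · simpa only [hlog] using hbarrier
  · exact fun s hs => ContinuousAt.continuousWithinAt (by fun_prop (disch := exact hpos hs.1))
  · intro s hs
    refine ((((Real.hasDerivAt_log (hpos hs.1.le)).const_mul (b / 2)).const_add a).add
      (((hasDerivAt_id s).const_sub (R ^ 2)).const_mul ε)).congr_deriv ?_
    ring
  · exact fun s hs => ((hasDerivAt_inv (hpos hs.1.le)).const_mul (b / 2)).sub_const ε
  · intro w hw
    have hw₀ : 0 < ‖w - y‖ := hr.trans hw.1
    refine (extremeEigSum_radialHessian_le hn _ _ (norm_pos_iff.1 hw₀)).trans_lt ?_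
    have hcancel : b / 2 * (‖w - y‖ ^ 2)⁻¹ - ε +
        b / 2 * -((‖w - y‖ ^ 2) ^ 2)⁻¹ * ‖w - y‖ ^ 2 = -ε := by
      field_simp
      ring
    rw [hcancel]
    linarith
  · intro w hw
    rw [hlog]
    exact (hin w hw).trans (le_add_of_nonneg_right
      (mul_nonneg hε.le (sub_nonneg.2 (pow_le_pow_left₀ hr.le hrR 2))))
  · intro w hw
    simpa only [hlog, sub_self, mul_zero, add_zero] using hout w hw

theorem IsViscositySubsolution.lt_of_mem_ball (hn : 2 ≤ n) {O : Set (Euc n)} {u : Euc n → ℝ}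
    (h : IsViscositySubsolution (extremeEigSum (two_pos.trans_le hn)) (fun _ => 0) O u)
    {y : Euc n} {R M : ℝ} (hO : Metric.ball y R ⊆ O) (hM : ∀ x ∈ O, u x ≤ M) (hy : u y < M)
    {x : Euc n} (hx : x ∈ Metric.ball y R) : u x < M := by
  have hR : 0 < R := Metric.pos_of_mem_ball hx
  obtain ⟨m, hym, hmM⟩ := exists_between hy
  have hnear : ∀ᶠ z in 𝓝 y, u z < m :=
    (h.1.mono hO y (Metric.mem_ball_self hR) m hym).filter_mono
      (Metric.isOpen_ball.nhdsWithin_eq (Metric.mem_ball_self hR)).ge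
  obtain ⟨r, hr, hball⟩ := Metric.eventually_nhds_iff_ball.1 hnear
  rcases lt_or_ge ‖x - y‖ r with hxr | hxr
  · exact (hball x (mem_ball_iff_norm.2 hxr)).trans hmM
  obtain ⟨R', hxR', hR'⟩ := exists_between (mem_ball_iff_norm.1 hx)
  have hannulus (z : Euc n) (hz : ‖z - y‖ ∈ Set.Icc (r / 2) R') : z ∈ O :=
    hO (mem_ball_iff_norm.2 (hz.2.trans_lt hR'))
  have hlog : Real.log (r / 2) < Real.log R' := Real.log_lt_log (half_pos hr) (by linarith)
  have hlog_x : Real.log ‖x - y‖ < Real.log R' := Real.log_lt_log (hr.trans_le hxr) hxR'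
  set b := (M - m) / (Real.log R' - Real.log (r / 2))
  have hb : 0 < b := div_pos (sub_pos.2 hmM) (sub_pos.2 hlog)
  have hslope : b * (Real.log R' - Real.log (r / 2)) = M - m :=
    div_mul_cancel₀ _ (sub_pos.2 hlog).ne'
  have hle := h.le_add_mul_log_of_le_on_spheres hn (a := M - b * Real.log R') (b := b)
    (half_pos hr) hannulus (fun z hz => ?_) (fun z hz => ?_) (x := x)
    ⟨(half_lt_self hr).le.trans hxr, hxR'.le⟩
  · linarith [mul_lt_mul_of_pos_left hlog_x hb]
  · linarith [hball z (mem_ball_iff_norm.2 (hz ▸ half_lt_self hr))]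
  · linarith [hM z (hannulus z ⟨by linarith, hz.le⟩)]

theorem IsViscositySubsolution.eq_of_isMaxOn (hn : 2 ≤ n) {O : Set (Euc n)} {u : Euc n → ℝ}
    (h : IsViscositySubsolution (extremeEigSum (two_pos.trans_le hn)) (fun _ => 0) O u)
    (hO : IsOpen O) (hconn : IsPreconnected O) {x₀ : Euc n} (hx₀ : x₀ ∈ O)
    (hmax : IsMaxOn u O x₀) {x : Euc n} (hx : x ∈ O) : u x = u x₀ := by
  refine (isMaxOn_iff.1 hmax x hx).eq_of_not_lt fun hlt => ?_
  set V := O ∩ u ⁻¹' Set.Iio (u x₀)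
  have hV : IsOpen V := by
    obtain ⟨W, hW, hVW⟩ := upperSemicontinuousOn_iff_preimage_Iio.1 h.1 (u x₀)
    exact (congrArg IsOpen hVW).mpr (hO.inter hW)
  have hclosed : closure V ∩ O ⊆ V := fun z ⟨hz, hzO⟩ => by
    obtain ⟨ε, hε, hball⟩ := Metric.isOpen_iff.1 hO z hzO
    obtain ⟨w, hw, hzw⟩ := Metric.mem_closure_iff.1 hz (ε / 2) (half_pos hε)
    have hsub : Metric.ball w (ε / 2) ⊆ O :=
      (Metric.ball_subset_ball' (by rw [dist_comm]; linarith)).trans hball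
    exact ⟨hzO, h.lt_of_mem_ball hn hsub (isMaxOn_iff.1 hmax) hw.2 hzw⟩
  exact lt_irrefl (u x₀)
    (hconn.subset_of_closure_inter_subset hV ⟨x, hx, hx, hlt⟩ hclosed hx₀).2

theorem IsViscositySubsolution.le_of_one_le_norm_sub (hn : 2 ≤ n) {p : Euc n} {u : Euc n → ℝ}
    (h : IsViscositySubsolution (extremeEigSum (two_pos.trans_le hn)) (fun _ => 0) {p}ᶜ u)
    (hbdd : BddAbove (u '' {p}ᶜ)) {M : ℝ} (hM : ∀ x, ‖x - p‖ = 1 → u x ≤ M) {x : Euc n}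
    (hx : 1 ≤ ‖x - p‖) : u x ≤ M := by
  obtain ⟨B, hB⟩ := hbdd
  have hne {w : Euc n} (hw : 1 ≤ ‖w - p‖) : w ∈ ({p}ᶜ : Set (Euc n)) :=
    sub_ne_zero.1 (norm_pos_iff.1 (one_pos.trans_le hw))
  refine le_of_forall_pos_le_add_mul (k := Real.log ‖x - p‖) fun ε hε => ?_
  have htendsto : Tendsto (fun R => M + ε * Real.log R) atTop atTop :=
    tendsto_atTop_add_const_left _ _ (Real.tendsto_log_atTop.const_mul_atTop hε)
  obtain ⟨R, hBR, hxR⟩ :=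
    ((htendsto.eventually_ge_atTop B).and (eventually_ge_atTop ‖x - p‖)).exists
  refine h.le_add_mul_log_of_le_on_spheres hn one_pos (fun w hw => hne hw.1) (fun w hw => ?_)
    (fun w hw => ?_) ⟨hx, hxR⟩
  · simpa using hM w hw
  · exact (hB ⟨w, hne (hw ▸ hx.trans hxR), rfl⟩).trans hBR

theorem IsViscositySubsolution.le_of_norm_sub_le_one (hn : 2 ≤ n) {p : Euc n} {u : Euc n → ℝ}
    (h : IsViscositySubsolution (extremeEigSum (two_pos.trans_le hn)) (fun _ => 0) {p}ᶜ u)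
    (hbdd : BddAbove (u '' {p}ᶜ)) {M : ℝ} (hM : ∀ x, ‖x - p‖ = 1 → u x ≤ M) {x : Euc n}
    (hxp : x ≠ p) (hx : ‖x - p‖ ≤ 1) : u x ≤ M := by
  obtain ⟨B, hB⟩ := hbdd
  have hx₀ : 0 < ‖x - p‖ := norm_sub_pos_iff.2 hxp
  refine le_of_forall_pos_le_add_mul (k := -Real.log ‖x - p‖) fun ε hε => ?_
  have htendsto : Tendsto (fun r => M + -ε * Real.log r) (𝓝[>] 0) atTop :=
    tendsto_atTop_add_const_left _ _
      (Real.tendsto_log_nhdsGT_zero.const_mul_atBot_of_neg (neg_neg_of_pos hε))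
  obtain ⟨r, hBr, hr, hrx⟩ := ((htendsto.eventually_ge_atTop B).and (Ioo_mem_nhdsGT hx₀)).exists
  have hne {w : Euc n} (hw : r ≤ ‖w - p‖) : w ∈ ({p}ᶜ : Set (Euc n)) :=
    sub_ne_zero.1 (norm_pos_iff.1 (hr.trans_le hw))
  rw [mul_neg, ← neg_mul]
  refine h.le_add_mul_log_of_le_on_spheres hn hr (fun w hw => hne hw.1) (fun w hw => ?_)
    (fun w hw => ?_) ⟨hrx.le, hx⟩
  · exact (hB ⟨w, hne hw.ge, rfl⟩).trans hBr
  · simpa using hM w hw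

theorem IsViscositySubsolution.exists_eq_const_of_compl_singleton (hn : 2 ≤ n) {p : Euc n}
    {u : Euc n → ℝ}
    (h : IsViscositySubsolution (extremeEigSum (two_pos.trans_le hn)) (fun _ => 0) {p}ᶜ u)
    (hbdd : BddAbove (u '' {p}ᶜ)) : ∃ c, ∀ x ∈ ({p}ᶜ : Set (Euc n)), u x = c := by
  have hrank : 1 < Module.finrank ℝ (Euc n) := by rwa [finrank_euclideanSpace_fin]
  have hsphere : Metric.sphere p 1 ⊆ ({p}ᶜ : Set (Euc n)) := fun x hx =>
    Metric.ne_of_mem_sphere hx one_ne_zero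
  have : Nontrivial (Euc n) := Module.nontrivial_of_finrank_pos (one_pos.trans hrank)
  obtain ⟨x₀, hx₀, hmax⟩ := UpperSemicontinuousOn.exists_isMaxOn
    (NormedSpace.sphere_nonempty.2 zero_le_one) (isCompact_sphere p 1) (h.1.mono hsphere)
  have hM (x : Euc n) (hx : ‖x - p‖ = 1) : u x ≤ u x₀ :=
    isMaxOn_iff.1 hmax x (mem_sphere_iff_norm.2 hx)
  have hglobal : IsMaxOn u {p}ᶜ x₀ := isMaxOn_iff.2 fun x hx =>
    (le_total 1 ‖x - p‖).elim (h.le_of_one_le_norm_sub hn hbdd hM)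
      (h.le_of_norm_sub_le_one hn hbdd hM hx)
  have hconn : IsPreconnected ({p}ᶜ : Set (Euc n)) :=
    (isConnected_compl_singleton_of_one_lt_rank
      (by rwa [← Module.finrank_eq_rank, Nat.one_lt_cast]) p).isPreconnected
  exact ⟨u x₀, fun x hx => h.eq_of_isMaxOn hn isOpen_compl_singleton hconn (hsphere hx₀)
    hglobal hx⟩

theorem IsViscositySubsolution.le_of_eig_zero (hn : 0 < n) {u : Euc n → ℝ}
    (h : IsViscositySubsolution (fun X => eig X ⟨0, hn⟩) (fun _ => 0) Set.univ u)
    (hbdd : BddAbove (Set.range u)) (x y : Euc n) : u x ≤ u y := by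
  obtain ⟨B, hB⟩ := hbdd
  -- The barrier `‖x - y‖ ^ (1 / 2)` tends to infinity although it is radially concave.
  refine le_of_forall_pos_le_add_mul (k := (‖x - y‖ ^ 2) ^ (1 / 4 : ℝ)) fun ε hε => ?_
  have htendsto : Tendsto (fun R : ℝ => u y + ε * (R ^ 2) ^ (1 / 4 : ℝ)) atTop atTop :=
    tendsto_atTop_add_const_left _ _ (((tendsto_rpow_atTop (by norm_num)).comp
      (tendsto_pow_atTop two_ne_zero)).const_mul_atTop hε)
  obtain ⟨R, hBR, hxR⟩ :=
    ((htendsto.eventually_ge_atTop B).and (eventually_ge_atTop ‖x - y‖)).exists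
  have hne {s : ℝ} (hs : s ∈ Set.Ioo ((0 : ℝ) ^ 2) (R ^ 2)) : s ≠ 0 := by
    simpa using hs.1.ne'
  refine h.le_radial_of_le_on_spheres (g := fun s => u y + ε * s ^ (1 / 4 : ℝ))
    (g' := fun s => ε * (1 / 4 * s ^ (1 / 4 - 1 : ℝ)))
    (g'' := fun s => ε * (1 / 4 * ((1 / 4 - 1) * s ^ (1 / 4 - 1 - 1 : ℝ)))) le_rfl
    (fun _ _ => trivial) ?_ ?_ ?_ ?_ ?_ ?_ ⟨norm_nonneg _, hxR⟩
  · exact (((Real.continuous_rpow_const (by norm_num)).const_mul ε).const_add _).continuousOn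
  · exact fun s hs => ((Real.hasDerivAt_rpow_const (Or.inl (hne hs))).const_mul ε).const_add _
  · exact fun s hs =>
      ((Real.hasDerivAt_rpow_const (Or.inl (hne hs))).const_mul (1 / 4)).const_mul ε
  · intro w hw
    refine (eig_zero_radialHessian_le hn _ _ (norm_pos_iff.1 hw.1)).trans_lt ?_
    have hs : 0 < ‖w - y‖ ^ 2 := pow_pos hw.1 2
    rw [Real.rpow_sub_one hs.ne' (1 / 4 - 1)]
    have hpos : 0 < (‖w - y‖ ^ 2) ^ (1 / 4 - 1 : ℝ) := Real.rpow_pos_of_pos hs _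
    generalize (‖w - y‖ ^ 2) ^ (1 / 4 - 1 : ℝ) = t at hpos ⊢
    have hw₀ : 0 < ‖w - y‖ := hw.1
    calc 2 * (ε * (1 / 4 * t))
          + 4 * (ε * (1 / 4 * ((1 / 4 - 1) * (t / ‖w - y‖ ^ 2)))) * ‖w - y‖ ^ 2
        = -(ε * t / 4) := by field_simp; ring
      _ < 0 := neg_neg_of_pos (by positivity)
  · intro w hw
    obtain rfl : w = y := by simpa [sub_eq_zero] using hw
    simp
  · exact fun w _ => (hB ⟨w, rfl⟩).trans hBR

theorem IsViscositySubsolution.exists_eq_const (hn : 0 < n) {u : Euc n → ℝ}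
    (h : IsViscositySubsolution (extremeEigSum hn) (fun _ => 0) Set.univ u)
    (hbdd : BddAbove (Set.range u)) : ∃ c, ∀ x, u x = c := by
  suffices hle : ∀ x y, u x ≤ u y from ⟨u 0, fun x => (hle x 0).antisymm (hle 0 x)⟩
  intro x y
  rcases Nat.lt_or_ge 1 n with hn₂ | hn₁
  · have : Nonempty (Fin n) := Fin.pos_iff_nonempty.1 hn
    obtain ⟨p, hp⟩ := Infinite.exists_notMem_finset ({x, y} : Finset (Euc n))
    rw [Finset.mem_insert, Finset.mem_singleton, not_or] at hp
    obtain ⟨c, hc⟩ := (h.mono isOpen_compl_singleton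
      (Set.subset_univ {p}ᶜ)).exists_eq_const_of_compl_singleton hn₂
        (hbdd.mono (Set.image_subset_range u _))
    rw [hc x (Ne.symm hp.1), hc y (Ne.symm hp.2)]
  · obtain rfl : n = 1 := by omega
    refine IsViscositySubsolution.le_of_eig_zero hn (h.of_forall_nonneg fun X hX => ?_) hbdd x y
    change 0 ≤ eig X 0 + eig X 0 at hX
    change 0 ≤ eig X 0
    linarith

end WeightedTrace

theorem mainTheorem12_general (n : ℕ) (hn : 0 < n) (a : Fin n → ℝ)
    (ha : WeightedTrace.AdmissibleWeights a) :
    (WeightedTrace.complWeight a ⟨0, hn⟩ ≤ a ⟨0, hn⟩ →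
      (2 ≤ n → ∀ u : WeightedTrace.Euc n → ℝ,
        WeightedTrace.IsViscositySubsolution (WeightedTrace.weightedTrace a) (fun _ => 0) {0}ᶜ u →
        BddAbove (u '' {0}ᶜ) →
        ∃ c : ℝ, ∀ x ∈ ({0}ᶜ : Set (WeightedTrace.Euc n)), u x = c) ∧
      ∀ u : WeightedTrace.Euc n → ℝ,
        WeightedTrace.IsViscositySubsolution (WeightedTrace.weightedTrace a) (fun _ => 0)
          Set.univ u →
        BddAbove (Set.range u) →
        ∃ c : ℝ, ∀ x, u x = c) ∧
    (WeightedTrace.complWeight a ⟨n - 1, Nat.sub_lt hn one_pos⟩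
        ≤ a ⟨n - 1, Nat.sub_lt hn one_pos⟩ →
      (2 ≤ n → ∀ v : WeightedTrace.Euc n → ℝ,
        WeightedTrace.IsViscositySupersolution (WeightedTrace.weightedTrace a) (fun _ => 0)
          {0}ᶜ v →
        BddBelow (v '' {0}ᶜ) →
        ∃ c : ℝ, ∀ x ∈ ({0}ᶜ : Set (WeightedTrace.Euc n)), v x = c) ∧
      ∀ v : WeightedTrace.Euc n → ℝ,
        WeightedTrace.IsViscositySupersolution (WeightedTrace.weightedTrace a) (fun _ => 0)
          Set.univ v →
        BddBelow (Set.range v) →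
        ∃ c : ℝ, ∀ x, v x = c) := by
  have hrev (h : WeightedTrace.complWeight a ⟨n - 1, Nat.sub_lt hn one_pos⟩ ≤
      a ⟨n - 1, Nat.sub_lt hn one_pos⟩) :
      WeightedTrace.complWeight (a ∘ Fin.rev) ⟨0, hn⟩ ≤ (a ∘ Fin.rev) ⟨0, hn⟩ := by
    rwa [WeightedTrace.complWeight_comp_rev]
  refine ⟨fun hle => ⟨fun hn₂ u hu hbdd => ?_, fun u hu hbdd => ?_⟩,
    fun hle => ⟨fun hn₂ v hv hbdd => ?_, fun v hv hbdd => ?_⟩⟩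
  · exact (hu.of_forall_nonneg fun X =>
      WeightedTrace.extremeEigSum_nonneg hn ha hle).exists_eq_const_of_compl_singleton hn₂ hbdd
  · exact (hu.of_forall_nonneg fun X =>
      WeightedTrace.extremeEigSum_nonneg hn ha hle).exists_eq_const hn hbdd
  · obtain ⟨c, hc⟩ := (hv.isViscositySubsolution_weightedTrace_rev.of_forall_nonneg fun X =>
      WeightedTrace.extremeEigSum_nonneg hn ha.comp_rev
        (hrev hle)).exists_eq_const_of_compl_singleton hn₂
          (by simpa only [Pi.neg_def, ← Set.image_neg_eq_neg, Set.image_image] using hbdd.neg)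
    exact ⟨-c, fun x hx => neg_eq_iff_eq_neg.1 (hc x hx)⟩
  · obtain ⟨c, hc⟩ := (hv.isViscositySubsolution_weightedTrace_rev.of_forall_nonneg fun X =>
      WeightedTrace.extremeEigSum_nonneg hn ha.comp_rev (hrev hle)).exists_eq_const hn
        (by simpa only [Pi.neg_def, Set.neg_range] using hbdd.neg)
    exact ⟨-c, fun x => neg_eq_iff_eq_neg.1 (hc x)⟩

theorem mainTheorem12 (n : ℕ) (hn : 0 < n) (a : Fin n → ℝ)
    (ha : WeightedTrace.AdmissibleWeights a) :
    (a ⟨0, hn⟩ = WeightedTrace.complWeight a ⟨0, hn⟩ →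
      ∀ u : WeightedTrace.Euc n → ℝ,
        WeightedTrace.IsViscositySubsolution (WeightedTrace.weightedTrace a) (fun _ => 0) {0}ᶜ u →
        BddAbove (u '' {0}ᶜ) →
        ∃ c : ℝ, ∀ x ∈ ({0}ᶜ : Set (WeightedTrace.Euc n)), u x = c) ∧
    (WeightedTrace.complWeight a ⟨0, hn⟩ < a ⟨0, hn⟩ →
      ∀ u : WeightedTrace.Euc n → ℝ,
        WeightedTrace.IsViscositySubsolution (WeightedTrace.weightedTrace a) (fun _ => 0)
          Set.univ u →
        BddAbove (Set.range u) →
        ∃ c : ℝ, ∀ x, u x = c) ∧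
    (a ⟨n - 1, Nat.sub_lt hn one_pos⟩
        = WeightedTrace.complWeight a ⟨n - 1, Nat.sub_lt hn one_pos⟩ →
      ∀ v : WeightedTrace.Euc n → ℝ,
        WeightedTrace.IsViscositySupersolution (WeightedTrace.weightedTrace a) (fun _ => 0)
          {0}ᶜ v →
        BddBelow (v '' {0}ᶜ) →
        ∃ c : ℝ, ∀ x ∈ ({0}ᶜ : Set (WeightedTrace.Euc n)), v x = c) ∧
    (WeightedTrace.complWeight a ⟨n - 1, Nat.sub_lt hn one_pos⟩
        < a ⟨n - 1, Nat.sub_lt hn one_pos⟩ →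
      ∀ v : WeightedTrace.Euc n → ℝ,
        WeightedTrace.IsViscositySupersolution (WeightedTrace.weightedTrace a) (fun _ => 0)
          Set.univ v →
        BddBelow (Set.range v) →
        ∃ c : ℝ, ∀ x, v x = c) := by
  obtain ⟨hsub, hsuper⟩ := mainTheorem12_general n hn a ha
  exact ⟨fun h => (hsub h.ge).1 (ha.two_le_of_eq_complWeight h), fun h => (hsub h.le).2,
    fun h => (hsuper h.ge).1 (ha.two_le_of_eq_complWeight h), fun h => (hsuper h.le).2⟩
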